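/- A Petri net is a triple $N=(P,T,F)$ with $P$ a non-empty set of places, $T$ a non-empty set of transitions, $P\cap T=\emptyset$, and $F\subseteq (P\times T)\cup(T\times P)$ such that the graph $(P\cup T,F)$ is weakly connected. Write ${}^\bullet x=\{y\mid (y,x)\in F\}$ and $x^\bullet=\{y\mid (x,y)\in F\}$. A marking is a multiset of places, $M(p)$ is the number of tokens of $M$ in $p$, and $M(X)=\sum_{p\in X}M(p)$ for $X\subseteq P$. A transition $t$ is enabled in $M$ if $M(p)\ge 1$ for all $p\in{}^\bullet t$; firing it leads to the marking $(M\setminus{}^\bullet t)\uplus t^\bullet$. Let $\mathrm{en}(N,M)$ be the set of transitions enabled in $M$, and $R(N,M)$ the set of markings reachable from $M$ by finite (possibly empty) firing sequences. The net $N$ is proper if ${}^\bullet t\ne\emptyset$ and $t^\bullet\neq\emptyset$ for all $t\in T$, and free-choice if for all $t_1,t_2\in T$ either ${}^\bullet t_1={}^\bullet t_2$ or ${}^\bullet t_1\cap{}^\bullet t_2=\emptyset$. The cluster of a node $x\in P\cup T$ is the smallest set $C$ containing $x$ such that $p^\bullet\subseteq C$ for each place $p\in C$ and ${}^\bullet t\subseteq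 C$ for each transition $t\in C$. A home cluster of $(N,M)$ is a cluster $C$ such that the marking $\mathrm{Mrk}(C)$ with exactly one token in each place of $C$ and no other tokens satisfies $\mathrm{Mrk}(C)\in R(N,M')$ for every $M'\in R(N,M)$. A pair $(M_1,M_2)$ of markings is a conflict-pair for $(N,M)$ if 1. $M_1,M_2\in R(N,M)$; 2. $\mathrm{en}(N,M_1)\neq\emptyset$ and $\mathrm{en}(N,M_2)\ne\emptyset$; 3. $\mathrm{en}(N,M_1)\cap\mathrm{en}(N,M_2)=\emptyset$; 4. $M_2({}^\bullet t)\ge 1$ for all $t\in\mathrm{en}(N,M_1)$; 5. $M_1({}^\bullet t)\ge 1$ for all $t\in\mathrm{en}(N,M_2)$. Theorem (Home Clusters Ensure Absence of Conflict-Pairs). Let $N$ be a proper free-choice Petri net and $M$ a marking of $N$ such that $(N,M)$ has a home cluster. Then $(N,M)$ has no conflict-pair. -/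

import Mathlib

/-- A Petri net with place set `P` and transition set `T`. The flow relation, a subset of
`(P × T) ∪ (T × P)`, is given by its two parts `PT` and `TP`. Both node sets are non-empty and
the underlying graph on the disjoint union `P ⊕ T` is weakly connected. -/
structure PetriNet (P : Type*) (T : Type*) where
  /-- the arcs from places to transitions -/
  PT : P → T → Prop
  /-- the arcs from transitions to places -/
  TP : T → P → Prop
  nonempty_places : Nonempty P
  nonempty_transitions : Nonempty T
  connected : ∀ x y : P ⊕ T,
    Relation.EqvGen
      (fun a b : P ⊕ T =>
        (∃ p t, a = Sum.inl p ∧ b = Sum.inr t ∧ PT p t) ∨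
        (∃ t p, a = Sum.inr t ∧ b = Sum.inl p ∧ TP t p)) x y

namespace PetriNet

/-- A marking: the multiset of places in which the place `p` occurs `M p` times. -/
abbrev Marking (P : Type*) := P → ℕ

variable {P : Type*} {T : Type*}

/-- The set of input places of a transition. -/
def pre (N : PetriNet P T) (t : T) : Set P := {p | N.PT p t}

/-- The set of output places of a transition. -/
def post (N : PetriNet P T) (t : T) : Set P := {p | N.TP t p}

/-- `M(X)`, the number of tokens that the marking `M` has in the set `X` of places, i.e. the sum
of `M p` over `p ∈ X` (which is `⊤` if infinitely many places of `X` are marked). -/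
noncomputable def tokens (M : Marking P) (X : Set P) : ℕ∞ :=
  ⨆ (s : Finset P) (_ : (s : Set P) ⊆ X), ((∑ p ∈ s, M p : ℕ) : ℕ∞)

theorem one_le_tokens_iff (M : Marking P) (X : Set P) :
    1 ≤ tokens M X ↔ ∃ p ∈ X, 1 ≤ M p := by
  constructor
  · intro h
    by_contra! hX
    have h0 : tokens M X = 0 := by
      refine le_antisymm (iSup₂_le fun s hs => ?_) bot_le
      have : ∑ p ∈ s, M p = 0 :=
        Finset.sum_eq_zero fun p hp => Nat.lt_one_iff.mp (hX p (hs hp))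
      simp [this]
    simp [h0] at h
  · rintro ⟨p, hp, h⟩
    have h1 : (1 : ℕ∞) ≤ ((∑ q ∈ ({p} : Finset P), M q : ℕ) : ℕ∞) := by
      simpa using h
    exact h1.trans (le_iSup₂_of_le {p} (by simpa using hp) le_rfl)

/-- `t` is enabled in `M`: every input place of `t` contains at least one token. -/
def Enabled (N : PetriNet P T) (M : Marking P) (t : T) : Prop := ∀ p ∈ N.pre t, 1 ≤ M p

/-- `en(N, M)`, the set of transitions that are enabled in `M`. -/
def en (N : PetriNet P T) (M : Marking P) : Set T := {t | N.Enabled M t}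

open Classical in
/-- The multiset in which every element of the set `X` of places occurs exactly once. -/
noncomputable def ofSet (X : Set P) : Marking P := fun p => if p ∈ X then 1 else 0

/-- The enabled transition `t` fires in `M` and results in `M' = (M ∖ pre t) ⊎ post t`. -/
def Fires (N : PetriNet P T) (M : Marking P) (t : T) (M' : Marking P) : Prop :=
  N.Enabled M t ∧ M' = M - ofSet (N.pre t) + ofSet (N.post t)

/-- The sequence of transitions can be fired from the first marking and leads to the second. -/
inductive FiresSeq (N : PetriNet P T) : Marking P → List T → Marking P → Prop
  | nil (M : Marking P) : FiresSeq N M [] M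
  | cons {M M' M'' : Marking P} {t : T} {σ : List T} :
      N.Fires M t M' → FiresSeq N M' σ M'' → FiresSeq N M (t :: σ) M''

/-- `R(N, M)`, the set of markings reachable from `M`. -/
def reachable (N : PetriNet P T) (M : Marking P) : Set (Marking P) :=
  {M' | ∃ σ : List T, N.FiresSeq M σ M'}

/-- `H` is a home marking of `(N, M)`. -/
def IsHomeMarking (N : PetriNet P T) (M H : Marking P) : Prop :=
  ∀ M' ∈ N.reachable M, H ∈ N.reachable M'

/-- Membership in the cluster of the node `x`: the smallest set that contains `x`, with each of
its places all output transitions of the place, and with each of its transitions all input places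
of the transition. -/
inductive InCluster (N : PetriNet P T) (x : P ⊕ T) : P ⊕ T → Prop
  | self : InCluster N x x
  | place {p : P} {t : T} : InCluster N x (Sum.inl p) → N.PT p t → InCluster N x (Sum.inr t)
  | transition {p : P} {t : T} :
      InCluster N x (Sum.inr t) → N.PT p t → InCluster N x (Sum.inl p)

/-- The cluster of the node `x`. -/
def cluster (N : PetriNet P T) (x : P ⊕ T) : Set (P ⊕ T) := {y | N.InCluster x y}

/-- The set of clusters of `N`. -/
def clusters (N : PetriNet P T) : Set (Set (P ⊕ T)) := Set.range N.cluster

/-- `Mrk(C)`: one token in each place of `C` and no other tokens. -/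
noncomputable def mrk (C : Set (P ⊕ T)) : Marking P := ofSet {p | Sum.inl p ∈ C}

/-- `C` is a home cluster of `(N, M)`. -/
def IsHomeCluster (N : PetriNet P T) (M : Marking P) (C : Set (P ⊕ T)) : Prop :=
  C ∈ N.clusters ∧ N.IsHomeMarking M (mrk C)

/-- Any two transitions have equal or disjoint sets of input places. -/
def IsFreeChoice (N : PetriNet P T) : Prop :=
  ∀ t₁ t₂ : T, N.pre t₁ = N.pre t₂ ∨ N.pre t₁ ∩ N.pre t₂ = ∅

/-- Every transition has an input place and an output place. -/
def IsProper (N : PetriNet P T) : Prop :=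
  ∀ t : T, (N.pre t).Nonempty ∧ (N.post t).Nonempty

/-- `(M₁, M₂)` is a conflict-pair for `(N, M)`. -/
structure IsConflictPair (N : PetriNet P T) (M M₁ M₂ : Marking P) : Prop where
  reachable_left : M₁ ∈ N.reachable M
  reachable_right : M₂ ∈ N.reachable M
  not_dead_left : N.en M₁ ≠ ∅
  not_dead_right : N.en M₂ ≠ ∅
  disjoint : N.en M₁ ∩ N.en M₂ = ∅
  marked_right : ∀ t ∈ N.en M₁, 1 ≤ tokens M₂ (N.pre t)
  marked_left : ∀ t ∈ N.en M₂, 1 ≤ tokens M₁ (N.pre t)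

end PetriNet

namespace PetriNet

/-! ### Firing sequences, free choice and clusters -/

section Firing

variable {P : Type*} {T : Type*} {N : PetriNet P T}

/-! Let `H` be the set of places of the home cluster. No reachable marking properly dominates
another (`eq_zero_of_reachable_add`), so one that marks all of `H` is the home marking
(`eq_ofSet_of_one_le`). Hence a path of places into `H` that meets each cluster at most once never
carries two tokens (`not_two_tokens`): both could be kept on the path until the home marking is
reached, which has at most one token there.

In a conflict-pair, let `t` be enabled in `M₁`. In `M₂` some input place `p` of `t` is marked and
another one, `q`, is empty. From `M₂` the home marking is reached by an acyclic choice of at most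
one transition per cluster (`FiresSeq.exists_isAllocation`, `IsAllocation.exists_firesSeq`), and the
token in `p` forces `q` to be marked on the way. The token in `q` traces back to a transition `f`
enabled in `M₂`, each of whose input places starts a path through `q` into `H`
(`FiresSeq.exists_enabled_isTrail`). But `M₁` marks some input place of `f`, and also `q`: two
tokens on one path. -/

theorem ofSet_of_mem {X : Set P} {p : P} (h : p ∈ X) : ofSet X p = 1 := by simp [ofSet, h]

theorem ofSet_of_notMem {X : Set P} {p : P} (h : p ∉ X) : ofSet X p = 0 := by simp [ofSet, h]

theorem ofSet_le_one (X : Set P) (p : P) : ofSet X p ≤ 1 := by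
  by_cases h : p ∈ X
  · simp [ofSet_of_mem h]
  · simp [ofSet_of_notMem h]

theorem Enabled.ofSet_le {X : Marking P} {t : T} (h : N.Enabled X t) (p : P) :
    ofSet (N.pre t) p ≤ X p := by
  by_cases hp : p ∈ N.pre t
  · rw [ofSet_of_mem hp]; exact h p hp
  · simp [ofSet_of_notMem hp]

theorem Enabled.mono {X Y : Marking P} {t : T} (h : N.Enabled X t) (hXY : ∀ p, X p ≤ Y p) :
    N.Enabled Y t := fun p hp => (h p hp).trans (hXY p)

theorem Enabled.exists_fires {X : Marking P} {t : T} (h : N.Enabled X t) :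
    ∃ X', N.Fires X t X' := ⟨_, h, rfl⟩

theorem Fires.apply {X X' : Marking P} {t : T} (h : N.Fires X t X') (p : P) :
    X' p = X p - ofSet (N.pre t) p + ofSet (N.post t) p := by
  rw [h.2]; rfl

theorem Fires.add_eq {X X' : Marking P} {t : T} (h : N.Fires X t X') (p : P) :
    X' p + ofSet (N.pre t) p = X p + ofSet (N.post t) p := by
  have := h.1.ofSet_le p
  have := h.apply p
  omega

theorem Fires.le_of_notMem_pre {X X' : Marking P} {t : T} (h : N.Fires X t X') {p : P}
    (hp : p ∉ N.pre t) : X p ≤ X' p := by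
  have := h.add_eq p
  rw [ofSet_of_notMem hp] at this
  omega

theorem Fires.le_of_notMem_post {X X' : Marking P} {t : T} (h : N.Fires X t X') {p : P}
    (hp : p ∉ N.post t) : X' p ≤ X p := by
  have := h.add_eq p
  rw [ofSet_of_notMem hp] at this
  omega

theorem Fires.one_le_of_mem_post {X X' : Marking P} {t : T} (h : N.Fires X t X') {p : P}
    (hp : p ∈ N.post t) : 1 ≤ X' p := by
  have := h.apply p
  rw [ofSet_of_mem hp] at this
  omega

theorem Fires.enabled_of_disjoint {X X' : Marking P} {t u : T} (h : N.Fires X t X')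
    (hu : N.Enabled X u) (hd : Disjoint (N.pre u) (N.pre t)) : N.Enabled X' u := fun p hp =>
  (hu p hp).trans (h.le_of_notMem_pre (Set.disjoint_left.1 hd hp))

theorem Fires.swap {X Y Z : Marking P} {t u : T} (ht : N.Fires X t Y) (hu : N.Fires Y u Z)
    (hX : N.Enabled X u) (hd : Disjoint (N.pre u) (N.pre t)) :
    ∃ Y', N.Fires X u Y' ∧ N.Fires Y' t Z := by
  obtain ⟨Y', hY'⟩ := hX.exists_fires
  obtain ⟨Z', hZ'⟩ := (hY'.enabled_of_disjoint ht.1 hd.symm).exists_fires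
  have : Z = Z' := by
    funext p
    have := ht.add_eq p
    have := hu.add_eq p
    have := hY'.add_eq p
    have := hZ'.add_eq p
    omega
  exact ⟨Y', hY', this ▸ hZ'⟩

theorem Fires.add_left {X X' : Marking P} {t : T} (h : N.Fires X t X') (K : Marking P) :
    N.Fires (X + K) t (X' + K) := by
  refine ⟨h.1.mono fun p => by simp, ?_⟩
  funext p
  have := h.1.ofSet_le p
  have := h.apply p
  simp only [Pi.add_apply, Pi.sub_apply]
  omega

theorem Fires.unique {X Y Z : Marking P} {t : T} (h : N.Fires X t Y) (h' : N.Fires X t Z) :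
    Y = Z := h.2.trans h'.2.symm

theorem FiresSeq.append {X Y Z : Marking P} {σ τ : List T} (h : N.FiresSeq X σ Y)
    (h' : N.FiresSeq Y τ Z) : N.FiresSeq X (σ ++ τ) Z := by
  induction h with
  | nil => exact h'
  | cons hf _ ih => exact .cons hf (ih h')

theorem reachable_of_firesSeq {M X Y : Marking P} {σ : List T} (hX : X ∈ N.reachable M)
    (h : N.FiresSeq X σ Y) : Y ∈ N.reachable M := by
  obtain ⟨τ, hτ⟩ := hX
  exact ⟨τ ++ σ, hτ.append h⟩

theorem reachable_of_fires {M X Y : Marking P} {t : T} (hX : X ∈ N.reachable M)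
    (h : N.Fires X t Y) : Y ∈ N.reachable M :=
  reachable_of_firesSeq hX (.cons h (.nil _))

theorem IsFreeChoice.pre_eq (hN : N.IsFreeChoice) {t u : T} {p : P} (ht : p ∈ N.pre t)
    (hu : p ∈ N.pre u) : N.pre t = N.pre u :=
  (hN t u).resolve_right fun h => (h ▸ (⟨ht, hu⟩ : p ∈ N.pre t ∩ N.pre u) : p ∈ (∅ : Set P))

theorem IsFreeChoice.disjoint_pre (hN : N.IsFreeChoice) {X : Marking P} {t u : T}
    (ht : N.Enabled X t) (hu : ¬ N.Enabled X u) : Disjoint (N.pre t) (N.pre u) :=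
  Set.disjoint_left.2 fun _ hp hp' => hu fun q hq => ht q (hN.pre_eq hp hp' ▸ hq)

theorem FiresSeq.enabled_of_disjoint {X Z : Marking P} {σ : List T} (h : N.FiresSeq X σ Z) {u : T}
    (hu : N.Enabled X u) (hd : ∀ t ∈ σ, Disjoint (N.pre u) (N.pre t)) : N.Enabled Z u := by
  induction h with
  | nil => exact hu
  | cons hf _ ih =>
    exact ih (hf.enabled_of_disjoint hu (hd _ (by simp))) fun t ht => hd t (by simp [ht])

/-- In a firing sequence, the first transition that satisfies `E` can be moved to the front if
the transitions satisfying `E` are initially enabled and in conflict with each other only. -/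
theorem FiresSeq.exists_expedite {X Z : Marking P} {σ : List T} (h : N.FiresSeq X σ Z)
    {E : T → Prop} (hE : ∀ t, E t → N.Enabled X t)
    (hd : ∀ t u, E t → ¬ E u → Disjoint (N.pre t) (N.pre u)) (hex : ∃ t ∈ σ, E t) :
    ∃ u Y τ, E u ∧ N.Fires X u Y ∧ N.FiresSeq Y τ Z ∧ τ.length < σ.length := by
  induction h with
  | nil => simp at hex
  | @cons X X' Z t σ hf hs ih =>
    by_cases ht : E t
    · exact ⟨t, X', σ, ht, hf, hs, by simp⟩
    · obtain ⟨u, Y, τ, hu, hfu, hτ, hlt⟩ :=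
        ih (fun u hu => hf.enabled_of_disjoint (hE u hu) (hd u t hu ht)) (by
          obtain ⟨v, hv, hEv⟩ := hex
          rcases List.mem_cons.1 hv with rfl | hv
          · exact absurd hEv ht
          · exact ⟨v, hv, hEv⟩)
      obtain ⟨Y', h1, h2⟩ := hf.swap hfu (hE u hu) (hd u t hu ht)
      exact ⟨u, Y', t :: τ, hu, h1, .cons h2 hτ, by simpa using hlt⟩

theorem FiresSeq.exists_enabled_of_consumed {X Z : Marking P} {σ : List T} (h : N.FiresSeq X σ Z)
    {p : P} (hX : 1 ≤ X p) (hZ : Z p = 0) :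
    ∃ τ v Y, N.FiresSeq X τ Y ∧ (∀ t ∈ τ, t ∈ σ) ∧ N.Enabled Y v ∧ p ∈ N.pre v := by
  induction h with
  | nil => omega
  | @cons X X' Z t σ hf hs ih =>
    by_cases hp : p ∈ N.pre t
    · exact ⟨[], t, X, .nil _, by simp, hf.1, hp⟩
    · obtain ⟨τ, v, Y, h1, h2, h3⟩ := ih (hX.trans (hf.le_of_notMem_pre hp)) hZ
      refine ⟨t :: τ, v, Y, .cons hf h1, fun s hs => ?_, h3⟩
      rcases List.mem_cons.1 hs with rfl | hs
      · simp
      · simp [h2 s hs]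

/-- Under free choice, generating a cluster stops after one round, because transitions sharing an
input place share all of them; `key` is this invariant. All later arguments use the home cluster
only through this property of `H`. -/
theorem pre_eq_places_of_mem_cluster (hN : N.IsFreeChoice) {C : Set (P ⊕ T)}
    (hC : C ∈ N.clusters) {t : T} {p : P} (hp : p ∈ N.pre t) (hpC : Sum.inl p ∈ C) :
    N.pre t = {q | Sum.inl q ∈ C} := by
  obtain ⟨x, rfl⟩ := hC
  have ht : N.InCluster x (Sum.inr t) := .place hpC hp
  refine Set.Subset.antisymm (fun q hq => .transition ht hq) fun q hq => ?_
  rcases x with p₀ | t₀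
  · have key : ∀ y, N.InCluster (Sum.inl p₀) y →
        Sum.elim (fun p => p = p₀ ∨ ∃ u, p₀ ∈ N.pre u ∧ p ∈ N.pre u)
          (fun u => p₀ ∈ N.pre u) y := by
      intro y hy
      induction hy with
      | self => exact Or.inl rfl
      | @place p u _ hpu ih =>
        rcases ih with rfl | ⟨v, h0, hv⟩
        · exact hpu
        · exact (hN.pre_eq hv hpu ▸ h0 : p₀ ∈ N.pre u)
      | @transition p u _ hpu ih => exact Or.inr ⟨u, ih, hpu⟩
    have h0 : p₀ ∈ N.pre t := key _ ht
    rcases key _ hq with rfl | ⟨u, hu0, hu⟩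
    · exact h0
    · exact hN.pre_eq hu0 h0 ▸ hu
  · have key : ∀ y, N.InCluster (Sum.inr t₀) y →
        Sum.elim (fun p => p ∈ N.pre t₀) (fun u => N.pre u = N.pre t₀) y := by
      intro y hy
      induction hy with
      | self => rfl
      | @place p u _ hpu ih => exact (hN.pre_eq ih hpu).symm
      | @transition p u _ hpu ih => exact (ih : N.pre u = _) ▸ hpu
    have h0 : N.pre t = N.pre t₀ := key _ ht
    exact h0 ▸ (key _ hq : q ∈ N.pre t₀)

end Firing

/-! ### Domination of markings and tokens on paths to the home cluster -/

section Domination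

variable {P : Type*} {T : Type*} {N : PetriNet P T} {M : Marking P} {H : Set P}

/-- The tokens of `ofSet H` are never consumed, so the sequence acts on the surplus `X` alone. Any
firing leaves the surplus non-zero, since every transition has an output place. -/
theorem eq_zero_of_firesSeq_ofSet (hproper : N.IsProper) {σ : List T} :
    ∀ {X : Marking P}, (∀ t ∈ σ, Disjoint (N.pre t) H) →
      N.FiresSeq (ofSet H + X) σ (ofSet H) → X = 0 := by
  induction σ with
  | nil =>
    intro X _ h
    generalize hZ : ofSet H + X = Z at h
    generalize hW : ofSet H = W at h
    cases h
    rw [hW] at hZ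
    simpa using hZ
  | cons u σ ih =>
    intro X hd h
    exfalso
    cases h with
    | @cons _ X' _ _ _ hf hs =>
      have hX' : X' = ofSet H + (X - ofSet (N.pre u) + ofSet (N.post u)) := by
        funext p
        have h1 := hf.apply p
        have h2 := hf.1.ofSet_le p
        simp only [Pi.add_apply, Pi.sub_apply] at h1 h2 ⊢
        by_cases hp : p ∈ N.pre u
        · have := ofSet_of_notMem (Set.disjoint_left.1 (hd u (by simp)) hp)
          omega
        · have := ofSet_of_notMem hp
          omega
      rw [hX'] at hs
      have h0 := ih (fun t ht => hd t (by simp [ht])) hs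
      obtain ⟨p, hp⟩ := (hproper u).2
      have := congrFun h0 p
      simp [ofSet_of_mem hp] at this

/-- A reachable marking never properly dominates another reachable marking. -/
theorem eq_zero_of_reachable_add (hproper : N.IsProper) (hfree : N.IsFreeChoice)
    (hhome : N.IsHomeMarking M (ofSet H))
    (hH : ∀ t, ∀ p ∈ N.pre t, p ∈ H → N.pre t = H) {Y K : Marking P}
    (hY : Y ∈ N.reachable M) (hYK : Y + K ∈ N.reachable M) : K = 0 := by
  obtain ⟨σ, hσ⟩ := hhome _ hYK
  clear hYK
  induction hn : σ.length using Nat.strong_induction_on generalizing Y σ with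
  | _ n ih =>
  -- A transition of `σ` enabled already in `Y` can be fired first from both markings, which keeps
  -- the difference `K` and shortens `σ`.
  by_cases hex : ∃ t ∈ σ, N.Enabled Y t
  · obtain ⟨u, X', τ, hu, hf, hτ, hlt⟩ := hσ.exists_expedite (E := N.Enabled Y)
      (fun t ht => ht.mono fun p => by simp) (fun t u ht hu => hfree.disjoint_pre ht hu) hex
    obtain ⟨Y', hY'⟩ := hu.exists_fires
    obtain rfl := hf.unique (hY'.add_left K)
    exact ih _ (hn ▸ hlt) (reachable_of_fires hY hY') τ hτ rfl
  · push Not at hex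
    -- A transition enabled in `Y` conflicts with nothing in `σ`, so it is still enabled in the home
    -- marking and its input places form `H`. If `Y` is dead, it is itself the home marking.
    have hle : ∀ p ∈ H, 1 ≤ Y p := by
      by_cases hd : ∃ d, N.Enabled Y d
      · obtain ⟨d, hd⟩ := hd
        have hd' := hσ.enabled_of_disjoint (hd.mono fun p => by simp)
          fun t ht => hfree.disjoint_pre hd (hex t ht)
        obtain ⟨p, hp⟩ := (hproper d).1
        have hpH : p ∈ H := by
          by_contra hpH
          have := hd' p hp
          simp [ofSet_of_notMem hpH] at this
        exact hH d p hp hpH ▸ hd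
      · obtain ⟨τ, hτ⟩ := hhome _ hY
        intro p hp
        generalize hW : ofSet H = W at hτ
        cases hτ with
        | nil => rw [← hW, ofSet_of_mem hp]
        | cons hf _ => exact absurd ⟨_, hf.1⟩ hd
    have hYK : Y + K = ofSet H + (Y - ofSet H + K) := by
      funext p
      simp only [Pi.add_apply, Pi.sub_apply]
      by_cases hp : p ∈ H
      · have := hle p hp
        have := ofSet_of_mem hp
        omega
      · have := ofSet_of_notMem hp
        omega
    rw [hYK] at hσ
    have h0 := eq_zero_of_firesSeq_ofSet hproper (fun t ht => Set.disjoint_left.2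
      fun p hp hpH => hex t ht fun q hq => hle q (hH t p hp hpH ▸ hq)) hσ
    funext p
    have := congrFun h0 p
    simp only [Pi.add_apply, Pi.zero_apply] at this ⊢
    omega

theorem eq_ofSet_of_one_le (hproper : N.IsProper) (hfree : N.IsFreeChoice)
    (hhome : N.IsHomeMarking M (ofSet H))
    (hH : ∀ t, ∀ p ∈ N.pre t, p ∈ H → N.pre t = H) {X : Marking P}
    (hX : X ∈ N.reachable M) (hle : ∀ p ∈ H, 1 ≤ X p) : X = ofSet H := by
  have heq : X = ofSet H + (X - ofSet H) := by
    funext p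
    simp only [Pi.add_apply, Pi.sub_apply]
    by_cases hp : p ∈ H
    · have := hle p hp
      have := ofSet_of_mem hp
      omega
    · have := ofSet_of_notMem hp
      omega
  have h0 := eq_zero_of_reachable_add hproper hfree hhome hH (hhome M ⟨[], .nil _⟩) (heq ▸ hX)
  rw [heq, h0, add_zero]

/-- A set of places from pairwise different clusters, along which every token can be moved to the
home cluster, holds at most one token. -/
theorem not_two_tokens (hproper : N.IsProper) (hfree : N.IsFreeChoice)
    (hhome : N.IsHomeMarking M (ofSet H))
    (hH : ∀ t, ∀ p ∈ N.pre t, p ∈ H → N.pre t = H) {Q : Set P} (rank : P → ℕ)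
    (hnext : ∀ x ∈ Q, x ∈ H ∨ ∃ t, ∃ y ∈ Q, x ∈ N.pre t ∧ y ∈ N.post t ∧ rank y < rank x)
    (hpre : ∀ t, ∀ x ∈ Q, ∀ y ∈ Q, x ∈ N.pre t → y ∈ N.pre t → x = y)
    (hQH : ∀ x ∈ Q, ∀ y ∈ Q, x ∈ H → y ∈ H → x = y)
    {X : Marking P} (hX : X ∈ N.reachable M) {x y : P} (hx : x ∈ Q) (hy : y ∈ Q)
    (hXx : 1 ≤ X x) (hXy : 1 ≤ X y) (hXxy : x = y → 2 ≤ X x) : False := by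
  induction hn : rank x + rank y using Nat.strong_induction_on generalizing X x y with
  | _ n ih =>
  have hne : X ≠ ofSet H := by
    rintro rfl
    have hmem : ∀ p, 1 ≤ ofSet H p → p ∈ H := fun p hp => by
      by_contra h
      simp [ofSet_of_notMem h] at hp
    have := hXxy (hQH x hx y hy (hmem x hXx) (hmem y hXy))
    have := ofSet_le_one H x
    omega
  -- Once some `u` can consume the token in `x`, free choice lets the transition given by `hnext`
  -- fire instead, lowering the rank sum. The other token stays, as `x` is the only input place of
  -- that transition in `Q`.
  have hmove : ∀ {X : Marking P} {u : T} {x y : P}, X ∈ N.reachable M → x ∈ Q → y ∈ Q →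
      1 ≤ X x → 1 ≤ X y → (x = y → 2 ≤ X x) → rank x + rank y = n → X ≠ ofSet H →
      N.Enabled X u → x ∈ N.pre u → False := by
    intro X u x y hX hx hy hXx hXy hXxy hn hne hu hxu
    rcases hnext x hx with hxH | ⟨t, z, hz, hxt, hzt, hlt⟩
    · exact hne (eq_ofSet_of_one_le hproper hfree hhome hH hX (hH u x hxu hxH ▸ hu))
    · have ht : N.Enabled X t := fun p hp => hu p (hfree.pre_eq hxt hxu ▸ hp)
      obtain ⟨X', hf⟩ := ht.exists_fires
      have h1 := hf.add_eq y
      have h2 := ofSet_le_one (N.pre t) y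
      have hy' : 1 ≤ X' y ∧ (z = y → 2 ≤ X' y) := by
        have hz' : z = y → ofSet (N.post t) y = 1 := fun h => ofSet_of_mem (h ▸ hzt)
        by_cases hxy : x = y
        · have := hXxy hxy
          subst hxy
          exact ⟨by omega, fun h => by have := hz' h; omega⟩
        · have := ofSet_of_notMem fun h => hxy (hpre t x hx y hy hxt h)
          exact ⟨by omega, fun h => by have := hz' h; omega⟩
      exact ih _ (by omega) (reachable_of_fires hX hf) hz hy (hf.one_le_of_mem_post hzt) hy'.1
        (fun h => h ▸ hy'.2 h) rfl
  -- Follow a run to the home marking up to the first transition that consumes from `x` or `y`;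
  -- without one, both tokens would survive into the home marking.
  obtain ⟨σ, hσ⟩ := hhome _ hX
  generalize hW : ofSet H = W at hσ
  induction hσ with
  | nil => exact hne hW.symm
  | @cons X X' Z u σ hf _ ihσ =>
    by_cases hxu : x ∈ N.pre u
    · exact hmove hX hx hy hXx hXy hXxy hn hne hf.1 hxu
    by_cases hyu : y ∈ N.pre u
    · exact hmove hX hy hx hXy hXx (fun h => h ▸ hXxy h.symm) (by omega) hne hf.1 hyu
    · have hX' := reachable_of_fires hX hf
      have h1 := hf.le_of_notMem_pre hxu
      have h2 := hf.le_of_notMem_pre hyu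
      have hXx' : 1 ≤ X' x := by omega
      have hXy' : 1 ≤ X' y := by omega
      have hXxy' : x = y → 2 ≤ X' x := fun h => (hXxy h).trans h1
      refine ihσ hX' hXx' hXy' hXxy' ?_ hW
      rintro rfl
      have hmem : ∀ p, 1 ≤ ofSet H p → p ∈ H := fun p hp => by
        by_contra h
        simp [ofSet_of_notMem h] at hp
      have := hXxy' (hQH x hx y hy (hmem x hXx') (hmem y hXy'))
      have := ofSet_le_one H x
      omega

end Domination

/-! ### Acyclic allocations leading to the home cluster -/

section Allocation

variable {P : Type*} {T : Type*} {N : PetriNet P T} {M : Marking P} {H : Set P}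

/-- The places of `H` together with the input places of the transitions in `L`. -/
def allocDomain (N : PetriNet P T) (H : Set P) : List T → Set P
  | [] => H
  | u :: L => N.pre u ∪ allocDomain N H L

/-- `L` picks at most one transition of each cluster, none from the cluster with places `H`, and
the picked transitions produce tokens only for later transitions of `L` and for `H`. -/
def IsAllocation (N : PetriNet P T) (H : Set P) : List T → Prop
  | [] => True
  | u :: L => IsAllocation N H L ∧ Disjoint (N.pre u) (allocDomain N H L) ∧
      N.post u ⊆ allocDomain N H L

theorem subset_allocDomain (L : List T) : H ⊆ N.allocDomain H L := by
  induction L with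
  | nil => exact subset_rfl
  | cons u L ih => exact ih.trans Set.subset_union_right

theorem pre_subset_allocDomain {L : List T} {t : T} (ht : t ∈ L) :
    N.pre t ⊆ N.allocDomain H L := by
  induction L with
  | nil => simp at ht
  | cons u L ih =>
    rcases List.mem_cons.1 ht with rfl | ht
    · exact Set.subset_union_left
    · exact (ih ht).trans Set.subset_union_right

theorem exists_mem_of_mem_allocDomain {L : List T} {p : P} (hp : p ∈ N.allocDomain H L) :
    p ∈ H ∨ ∃ t ∈ L, p ∈ N.pre t := by
  induction L with
  | nil => exact Or.inl hp
  | cons u L ih =>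
    rcases hp with hp | hp
    · exact Or.inr ⟨u, by simp, hp⟩
    · rcases ih hp with h | ⟨t, ht, h⟩
      · exact Or.inl h
      · exact Or.inr ⟨t, by simp [ht], h⟩

theorem IsAllocation.post_subset {L : List T} (hL : N.IsAllocation H L) {t : T} (ht : t ∈ L) :
    N.post t ⊆ N.allocDomain H L := by
  induction L with
  | nil => simp at ht
  | cons u L ih =>
    rcases List.mem_cons.1 ht with rfl | ht
    · exact hL.2.2.trans Set.subset_union_right
    · exact (ih hL.1 ht).trans Set.subset_union_right

theorem pre_subset_allocDomain_of_mem (hfree : N.IsFreeChoice)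
    (hH : ∀ t, ∀ p ∈ N.pre t, p ∈ H → N.pre t = H) {L : List T} {t : T} {p : P}
    (hp : p ∈ N.pre t) (hpL : p ∈ N.allocDomain H L) : N.pre t ⊆ N.allocDomain H L := by
  rcases exists_mem_of_mem_allocDomain hpL with h | ⟨u, hu, h⟩
  · exact hH t p hp h ▸ subset_allocDomain L
  · exact hfree.pre_eq hp h ▸ pre_subset_allocDomain hu

/-- Read backwards, the run contributes a transition whenever its cluster is new, so each cluster
keeps its last occurrence. Tokens produced there are consumed only later in the run or remain in
`H`. -/
theorem FiresSeq.exists_isAllocation (hfree : N.IsFreeChoice)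
    (hH : ∀ t, ∀ p ∈ N.pre t, p ∈ H → N.pre t = H) {X : Marking P} {σ : List T}
    (h : N.FiresSeq X σ (ofSet H)) :
    ∃ L, N.IsAllocation H L ∧ ∀ p, 1 ≤ X p → p ∈ N.allocDomain H L := by
  generalize hW : ofSet H = W at h
  induction h with
  | nil =>
    subst hW
    refine ⟨[], trivial, fun p hp => ?_⟩
    by_contra h
    simp [ofSet_of_notMem (show p ∉ H from h)] at hp
  | @cons X X' Z u σ hf _ ih =>
    obtain ⟨L, hL, hX'⟩ := ih hW
    by_cases hu : ∃ p ∈ N.pre u, p ∈ N.allocDomain H L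
    · obtain ⟨q, hq, hqL⟩ := hu
      refine ⟨L, hL, fun p hp => ?_⟩
      by_cases hpu : p ∈ N.pre u
      · exact pre_subset_allocDomain_of_mem hfree hH hq hqL hpu
      · exact hX' p (hp.trans (hf.le_of_notMem_pre hpu))
    · push Not at hu
      refine ⟨u :: L, ⟨hL, Set.disjoint_left.2 hu,
        fun p hp => hX' p (hf.one_le_of_mem_post hp)⟩, fun p hp => ?_⟩
      by_cases hpu : p ∈ N.pre u
      · exact Or.inl hpu
      · exact Or.inr (hX' p (hp.trans (hf.le_of_notMem_pre hpu)))

theorem exists_firesSeq_replicate_not_enabled (hproper : N.IsProper) {u : T}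
    (hu : Disjoint (N.pre u) (N.post u)) (X : Marking P) :
    ∃ k Z, N.FiresSeq X (List.replicate k u) Z ∧ ¬ N.Enabled Z u := by
  obtain ⟨p, hp⟩ := (hproper u).1
  induction hn : X p generalizing X with
  | zero => exact ⟨0, X, .nil _, fun h => by have := h p hp; omega⟩
  | succ n ih =>
    by_cases hX : N.Enabled X u
    · obtain ⟨X', hf⟩ := hX.exists_fires
      have h1 := hf.add_eq p
      rw [ofSet_of_mem hp, ofSet_of_notMem (Set.disjoint_left.1 hu hp)] at h1
      obtain ⟨k, Z, hk, hZ⟩ := ih X' (by omega)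
      exact ⟨k + 1, Z, .cons hf hk, hZ⟩
    · exact ⟨0, X, .nil _, hX⟩

theorem FiresSeq.le_of_forall_notMem_post {X Z : Marking P} {σ : List T} (h : N.FiresSeq X σ Z)
    {p : P} (hp : ∀ t ∈ σ, p ∉ N.post t) : Z p ≤ X p := by
  induction h with
  | nil => exact le_rfl
  | cons hf _ ih =>
    exact (ih fun t ht => hp t (by simp [ht])).trans (hf.le_of_notMem_post (hp _ (by simp)))

/-- Exhaust the transitions in list order: later ones never refill the input places of earlier ones.
-/
theorem IsAllocation.exists_maximal_firesSeq (hproper : N.IsProper) {L : List T}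
    (hL : N.IsAllocation H L) (X : Marking P) :
    ∃ σ Z, N.FiresSeq X σ Z ∧ (∀ t ∈ σ, t ∈ L) ∧ ∀ t ∈ L, ¬ N.Enabled Z t := by
  induction L generalizing X with
  | nil => exact ⟨[], X, .nil _, by simp, by simp⟩
  | cons u L ih =>
    obtain ⟨hL', hd, hpost⟩ := hL
    obtain ⟨k, Y, hk, hY⟩ := exists_firesSeq_replicate_not_enabled hproper (hd.mono_right hpost) X
    obtain ⟨σ, Z, hσ, hσL, hZ⟩ := ih hL' Y
    refine ⟨_, Z, hk.append hσ, fun t ht => ?_, fun t ht => ?_⟩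
    · rcases List.mem_append.1 ht with ht | ht
      · simp [List.eq_of_mem_replicate ht]
      · simp [hσL t ht]
    · rcases List.mem_cons.1 ht with rfl | ht
      · exact fun h => hY fun p hp => (h p hp).trans (hσ.le_of_forall_notMem_post
          fun s hs hps => Set.disjoint_left.1 hd hp (hL'.post_subset (hσL s hs) hps))
      · exact hZ t ht

/-- In the marking where `L` is exhausted, all tokens lie in the domain. A transition enabled there
belongs to the cluster of some `s ∈ L`, which would then be enabled too, or takes its tokens from
`H`, which forces the home marking. -/
theorem IsAllocation.exists_firesSeq (hproper : N.IsProper) (hfree : N.IsFreeChoice)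
    (hhome : N.IsHomeMarking M (ofSet H))
    (hH : ∀ t, ∀ p ∈ N.pre t, p ∈ H → N.pre t = H) {L : List T} (hL : N.IsAllocation H L)
    {X : Marking P} (hX : X ∈ N.reachable M) (hXL : ∀ p, 1 ≤ X p → p ∈ N.allocDomain H L) :
    ∃ σ, N.FiresSeq X σ (ofSet H) ∧ ∀ t ∈ σ, t ∈ L := by
  obtain ⟨σ, Z, hσ, hσL, hZ⟩ := hL.exists_maximal_firesSeq hproper X
  have hZM := reachable_of_firesSeq hX hσ
  have hZL : ∀ p, 1 ≤ Z p → p ∈ N.allocDomain H L := fun p hp => by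
    by_contra h
    have := hσ.le_of_forall_notMem_post fun t ht hpt => h (hL.post_subset (hσL t ht) hpt)
    exact h (hXL p (hp.trans this))
  suffices Z = ofSet H from ⟨σ, this ▸ hσ, hσL⟩
  obtain ⟨τ, hτ⟩ := hhome Z hZM
  generalize hW : ofSet H = W at hτ ⊢
  cases hτ with
  | nil => rfl
  | @cons _ _ _ t _ hf _ =>
    obtain ⟨p, hp⟩ := (hproper t).1
    rcases exists_mem_of_mem_allocDomain (hZL p (hf.1 p hp)) with h | ⟨s, hs, h⟩
    · exact hW ▸ eq_ofSet_of_one_le hproper hfree hhome hH hZM (hH t p hp h ▸ hf.1)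
    · exact absurd (fun q hq => hf.1 q (hfree.pre_eq hp h ▸ hq)) (hZ s hs)

end Allocation

/-! ### Trails along an allocation -/

section Trail

variable {P : Type*} {T : Type*} {N : PetriNet P T} {M : Marking P} {H : Set P}

/-- `Q` is the set of places of a path that starts in `x`, follows transitions of `L` in the order
of `L`, and ends in `H`. -/
def IsTrail (N : PetriNet P T) (H : Set P) : List T → P → Set P → Prop
  | [], x, Q => x ∈ H ∧ Q = {x}
  | u :: L, x, Q => IsTrail N H L x Q ∨
      x ∈ N.pre u ∧ ∃ y ∈ N.post u, ∃ Q', IsTrail N H L y Q' ∧ Q = insert x Q'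

open Classical in
/-- The position, counted from the end, of the transition of `L` that has `p` as an input place;
zero if there is none. -/
noncomputable def allocRank (N : PetriNet P T) : List T → P → ℕ
  | [], _ => 0
  | u :: L, p => if p ∈ N.pre u then L.length + 1 else allocRank N L p

theorem allocRank_le_length (L : List T) (p : P) : N.allocRank L p ≤ L.length := by
  induction L with
  | nil => simp [allocRank]
  | cons u L ih =>
    simp only [allocRank, List.length_cons]
    split_ifs <;> omega

theorem IsTrail.mem {L : List T} {x : P} {Q : Set P} (h : N.IsTrail H L x Q) : x ∈ Q := by
  induction L with
  | nil => simp [h.2]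
  | cons u L ih =>
    rcases h with h | ⟨_, y, _, Q', _, rfl⟩
    · exact ih h
    · simp

theorem IsTrail.subset_allocDomain {L : List T} {x : P} {Q : Set P} (h : N.IsTrail H L x Q) :
    Q ⊆ N.allocDomain H L := by
  induction L generalizing x Q with
  | nil => rw [h.2]; exact Set.singleton_subset_iff.2 h.1
  | cons u L ih =>
    rcases h with h | ⟨hx, y, _, Q', hQ', rfl⟩
    · exact (ih h).trans Set.subset_union_right
    · exact Set.insert_subset (Or.inl hx) ((ih hQ').trans Set.subset_union_right)

theorem IsAllocation.exists_isTrail (hproper : N.IsProper) {L : List T}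
    (hL : N.IsAllocation H L) {x : P} (hx : x ∈ N.allocDomain H L) : ∃ Q, N.IsTrail H L x Q := by
  induction L generalizing x with
  | nil => exact ⟨_, hx, rfl⟩
  | cons u L ih =>
    rcases hx with hx | hx
    · obtain ⟨y, hy⟩ := (hproper u).2
      obtain ⟨Q, hQ⟩ := ih hL.1 (hL.2.2 hy)
      exact ⟨_, Or.inr ⟨hx, y, hy, Q, hQ, rfl⟩⟩
    · obtain ⟨Q, hQ⟩ := ih hL.1 hx
      exact ⟨Q, Or.inl hQ⟩

theorem IsTrail.insert {L : List T} (hL : N.IsAllocation H L) {t : T} (ht : t ∈ L) {x y : P}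
    {Q : Set P} (hx : x ∈ N.pre t) (hy : y ∈ N.post t) (hQ : N.IsTrail H L y Q) :
    N.IsTrail H L x (insert x Q) := by
  induction L with
  | nil => simp at ht
  | cons u L ih =>
    have hyL : y ∈ N.allocDomain H L := by
      rcases List.mem_cons.1 ht with rfl | ht
      · exact hL.2.2 hy
      · exact hL.1.post_subset ht hy
    have hQ' : N.IsTrail H L y Q :=
      hQ.resolve_right fun h => Set.disjoint_left.1 hL.2.1 h.1 hyL
    rcases List.mem_cons.1 ht with rfl | ht
    · exact Or.inr ⟨hx, y, hy, Q, hQ', rfl⟩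
    · exact Or.inl (ih hL.1 ht hQ')

/-- These are the hypotheses of `not_two_tokens` for a trail, with `allocRank` as the rank. -/
theorem IsTrail.rank_properties (hfree : N.IsFreeChoice) {L : List T}
    (hL : N.IsAllocation H L) {x : P} {Q : Set P} (hQ : N.IsTrail H L x Q) :
    (∀ a ∈ Q, a ∈ H ∨ ∃ t, ∃ b ∈ Q, a ∈ N.pre t ∧ b ∈ N.post t ∧
      N.allocRank L b < N.allocRank L a) ∧
    (∀ t, ∀ a ∈ Q, ∀ b ∈ Q, a ∈ N.pre t → b ∈ N.pre t → a = b) ∧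
    ∀ a ∈ Q, ∀ b ∈ Q, a ∈ H → b ∈ H → a = b := by
  induction L generalizing x Q with
  | nil =>
    obtain ⟨hx, rfl⟩ := hQ
    refine ⟨fun a ha => Or.inl (by rwa [Set.mem_singleton_iff.1 ha]), ?_, ?_⟩ <;> simp_all
  | cons u L ih =>
    obtain ⟨hL', hd, hpost⟩ := hL
    have hrank : ∀ a ∈ N.allocDomain H L, N.allocRank (u :: L) a = N.allocRank L a :=
      fun a ha => if_neg (Set.disjoint_right.1 hd ha)
    have hstep : ∀ {x : P} {Q : Set P}, N.IsTrail H L x Q → ∀ a ∈ Q, a ∈ H ∨ ∃ t, ∃ b ∈ Q,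
        a ∈ N.pre t ∧ b ∈ N.post t ∧ N.allocRank (u :: L) b < N.allocRank (u :: L) a := by
      intro x Q hQ a ha
      rcases (ih hL' hQ).1 a ha with h | ⟨t, b, hb, hat, hbt, hlt⟩
      · exact Or.inl h
      · refine Or.inr ⟨t, b, hb, hat, hbt, ?_⟩
        rwa [hrank a (hQ.subset_allocDomain ha), hrank b (hQ.subset_allocDomain hb)]
    rcases hQ with hQ | ⟨hx, y, hy, Q', hQ', rfl⟩
    · exact ⟨hstep hQ, (ih hL' hQ).2⟩
    · obtain ⟨-, h2, h3⟩ := ih hL' hQ'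
      have hsub := hQ'.subset_allocDomain
      have hxH : x ∉ H := fun h => Set.disjoint_left.1 hd hx (PetriNet.subset_allocDomain L h)
      have hxt : ∀ t, x ∈ N.pre t → ∀ b ∈ Q', b ∉ N.pre t := fun t ht b hb hbt =>
        Set.disjoint_left.1 hd (hfree.pre_eq ht hx ▸ hbt) (hsub hb)
      refine ⟨?_, ?_, ?_⟩
      · rintro a (rfl | ha)
        · refine Or.inr ⟨u, y, Or.inr hQ'.mem, hx, hy, ?_⟩
          rw [hrank y (hpost hy), show N.allocRank (u :: L) a = L.length + 1 from if_pos hx]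
          exact Nat.lt_succ_of_le (allocRank_le_length L y)
        · rcases hstep hQ' a ha with h | ⟨t, b, hb, h⟩
          · exact Or.inl h
          · exact Or.inr ⟨t, b, Or.inr hb, h⟩
      · rintro t a (rfl | ha) b (rfl | hb) hat hbt
        · rfl
        · exact absurd hbt (hxt t hat b hb)
        · exact absurd hat (hxt t hbt a ha)
        · exact h2 t a ha b hb hat hbt
      · rintro a (rfl | ha) b (rfl | hb) haH hbH
        · rfl
        · exact absurd haH hxH
        · exact absurd hbH hxH
        · exact h3 a ha b hb haH hbH

/-- A token that is produced by transitions of an allocation can be traced back to one of them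
that is initially enabled. -/
theorem FiresSeq.exists_enabled_isTrail (hproper : N.IsProper) {L : List T}
    (hL : N.IsAllocation H L) {X Z : Marking P} {σ : List T} (h : N.FiresSeq X σ Z)
    (hσ : ∀ t ∈ σ, t ∈ L) {q : P} (hX : X q = 0) (hZ : 1 ≤ Z q) :
    ∃ f, N.Enabled X f ∧ ∀ r ∈ N.pre f, ∃ Q, N.IsTrail H L r Q ∧ q ∈ Q := by
  induction h with
  | nil => omega
  | @cons X X' Z u σ hf _ ih =>
    have hu : u ∈ L := hσ u (by simp)
    have hpost : ∀ p, X p = 0 → 1 ≤ X' p → p ∈ N.post u := fun p h0 h1 => by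
      by_contra h
      have := hf.le_of_notMem_post h
      omega
    by_cases hq : X' q = 0
    · obtain ⟨f, hfe, hft⟩ := ih (fun t ht => hσ t (by simp [ht])) hq hZ
      by_cases hfX : N.Enabled X f
      · exact ⟨f, hfX, hft⟩
      -- An input place of `f` empty in `X` was filled by `u`, so `u` takes over the role of `f` and
      -- the trail is extended backwards through `u`.
      · simp only [Enabled, not_forall] at hfX
        obtain ⟨p, hp, hpX⟩ := hfX
        obtain ⟨Q, hQ, hqQ⟩ := hft p hp
        exact ⟨u, hf.1, fun r hr => ⟨_, hQ.insert hL hu hr (hpost p (by omega) (hfe p hp)),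
          Or.inr hqQ⟩⟩
    · have hqu := hpost q hX (by omega)
      obtain ⟨Q, hQ⟩ := hL.exists_isTrail hproper (hL.post_subset hu hqu)
      exact ⟨u, hf.1, fun r hr => ⟨_, hQ.insert hL hu hr hqu, Or.inr hQ.mem⟩⟩

end Trail

end PetriNet

/-! ### Absence of conflict-pairs -/

theorem theorem2 {P : Type*} {T : Type*} (N : PetriNet P T) (M : PetriNet.Marking P)
    (hproper : N.IsProper) (hfree : N.IsFreeChoice)
    (hhome : ∃ C : Set (P ⊕ T), N.IsHomeCluster M C) :
    ¬ ∃ M₁ M₂ : PetriNet.Marking P, N.IsConflictPair M M₁ M₂ := by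
  rintro ⟨M₁, M₂, hc⟩
  obtain ⟨C, hC, hhome⟩ := hhome
  obtain ⟨H, hHC⟩ : ∃ H : Set P, H = {p | Sum.inl p ∈ C} := ⟨_, rfl⟩
  have hH : ∀ t, ∀ p ∈ N.pre t, p ∈ H → N.pre t = H := fun t p hp hpH => by
    subst hHC
    exact PetriNet.pre_eq_places_of_mem_cluster hfree hC hp hpH
  rw [PetriNet.mrk, ← hHC] at hhome
  obtain ⟨t, ht⟩ := Set.nonempty_iff_ne_empty.2 hc.not_dead_left
  have ht₂ : ¬ N.Enabled M₂ t := fun h =>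
    (hc.disjoint ▸ (⟨ht, h⟩ : t ∈ N.en M₁ ∩ N.en M₂) : t ∈ (∅ : Set T))
  obtain ⟨p, hp, hpM⟩ := (PetriNet.one_le_tokens_iff _ _).1 (hc.marked_right t ht)
  obtain ⟨q, hq, hqM⟩ : ∃ q ∈ N.pre t, M₂ q = 0 := by
    by_contra! h
    exact ht₂ fun q hq => Nat.one_le_iff_ne_zero.2 (h q hq)
  obtain ⟨σ, hσ⟩ := hhome M₂ hc.reachable_right
  obtain ⟨L, hL, hML⟩ := hσ.exists_isAllocation hfree hH
  obtain ⟨ω, hω, hωL⟩ := hL.exists_firesSeq hproper hfree hhome hH hc.reachable_right hML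
  -- If `p ∈ H`, then `q ∈ H` is marked at the end. Otherwise the token in `p` must be consumed, by
  -- a transition that also needs a token in `q`.
  obtain ⟨τ, Y, hτ, hτL, hY⟩ : ∃ τ Y, N.FiresSeq M₂ τ Y ∧ (∀ s ∈ τ, s ∈ L) ∧ 1 ≤ Y q := by
    by_cases hpH : p ∈ H
    · exact ⟨ω, _, hω, hωL, (PetriNet.ofSet_of_mem (hH t p hp hpH ▸ hq)).ge⟩
    · obtain ⟨τ, v, Y, h1, h2, h3, h4⟩ :=
        hω.exists_enabled_of_consumed hpM (PetriNet.ofSet_of_notMem hpH)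
      exact ⟨τ, Y, h1, fun s hs => hωL s (h2 s hs), h3 q (hfree.pre_eq hp h4 ▸ hq)⟩
  obtain ⟨f, hf, hft⟩ := hτ.exists_enabled_isTrail hproper hL hτL hqM hY
  obtain ⟨r, hr, hrM⟩ := (PetriNet.one_le_tokens_iff _ _).1 (hc.marked_left f hf)
  obtain ⟨Q, hQ, hqQ⟩ := hft r hr
  obtain ⟨h1, h2, h3⟩ := hQ.rank_properties hfree hL
  refine PetriNet.not_two_tokens hproper hfree hhome hH _ h1 h2 h3 hc.reachable_left hQ.mem hqQ
    hrM (ht q hq) ?_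
  -- The two places differ: `M₂` marks `r`, an input place of the enabled `f`, but not `q`.
  rintro rfl
  have := hf r hr
  omega
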